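/- **Theorem 3.3 (local convergence of RGPS).** Let $n\ge 1$, $A=[a_1,\dots,a_m]\in\mathbb C^{n\times m}$ with $A^*$ of full column rank, $x^\natural\in\mathbb C^n$, $y^\natural=A^*x^\natural$, $z^\natural=(x^\natural,y^\natural)\in\mathbb C^{n+m}$, and $b=|y^\natural|$ (elementwise) with all $b_i>0$. Assume that magnitude retrieval is unique: every $x\in\mathbb C^n$ with $\frac{a_i^*x}{|a_i^*x|}=\pm\frac{a_i^*x^\natural}{|a_i^*x^\natural|}$ for all $i$ (signs depending on $i$, and $0/|0|:=0$) equals $c\,x^\natural$ for some $c\in\mathbb R\setminus\{0\}$. *Algorithm.* Let $\Pi$ be the orthogonal projection of $\mathbb C^{n+m}$ onto the graph $\{(x,y):A^*x=y\}$ and $t\in\mathbb R$. RGPS (noiseless, without prior) is the iteration, from arbitrary $x^0,\lambda^0\in\mathbb C^n$ and $y^0,\nu^0\in\mathbb C^m$, $$(x^{k+\frac12},y^{k+\frac12})=(tI+(1-t)\Pi)(x^k-\lambda^k,\,y^k-\nu^k),$$ $$x^{k+1}=x^{k+\frac12}+\lambda^k,\qquad y^{k+1}=b\circ\frac{y^{k+\frac12}+\nu^k}{|y^{k+\frac12}+\nu^k|},$$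 $$\lambda^{k+1}=\lambda^k+x^{k+\frac12}-x^{k+1},\qquad \nu^{k+1}=\nu^k+y^{k+\frac12}-y^{k+1},$$ with elementwise operations and $0/|0|:=0$. Put $z_{\mathrm{DR}}^k=(\lambda^k+x^k,\nu^k+y^k)$. For $k\ge1$ it satisfies $z_{\mathrm{DR}}^{k+1}=T(z_{\mathrm{DR}}^k)$, where $T(z)=z+(tI+(1-t)\Pi)(2P(z)-z)-P(z)$ and $P(x,y)=(x,\,b\circ y/|y|)$. Let $\operatorname{dist}(u,v)=\min_{|\alpha|=1}\|u-\alpha v\|$ and $\mathcal F_0=\{\alpha z^\natural:|\alpha|=1\}$. *Constants.* Let $L\in\mathbb C^{n\times n}$ satisfy $LL^*=I+AA^*$ (e.g. the Cholesky factor), let $\Omega$ be a diagonal unitary matrix whose diagonal entries are the phases of the entries of $z^\natural$ (an arbitrary unimodular number where an entry of $x^\natural$ is zero), and let $B=(L^{-1},\,L^{-1}A)\,\Omega$. Let $\sigma_2$ be the second largest singular value (with multiplicity) of the real matrix $\begin{pmatrix}\operatorname{Re}B\\ \operatorname{Im}B\end{pmatrix}\in\mathbb R^{2n\times(n+m)}$,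 let $s_{\min}(A)$ be the smallest nonzero singular value of $A$, and set $$\delta_1=\frac1{\sqrt{1+s_{\min}(A)^2}},\qquad \tilde\beta^2=\max\{\sigma_2^2+(1-\sigma_2^2)\delta_1^2,\ \sigma_2^2\}\ \ (\tilde\beta\ge0),\qquad t_{\max}=\frac{2(1-\tilde\beta^2)}{2-\tilde\beta^2}.$$ *Claim.* One has $0<\tilde\beta<1$ and $0<t_{\max}<1$, and for every $t$ with $0<t<t_{\max}$ there are $0<\gamma<1$, a function $\varepsilon$ with $\varepsilon(\rho)\to0$ as $\rho\downarrow0$, and $r>0$ such that 1. among the points $z$ with $\operatorname{dist}(z,z^\natural)<r$, the fixed points of $T$ are exactly the elements of $\mathcal F_0$; 2. for every RGPS sequence with $\rho:=\operatorname{dist}(z_{\mathrm{DR}}^1,z^\natural)<r$ and every $k\ge1$, $$\operatorname{dist}(x^k,x^\natural)\le(\gamma+\varepsilon(\rho))^{k-1}\rho .$$ -/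

import Mathlib

open Filter Topology
open scoped Matrix

noncomputable section

namespace PhaseRetrieval

/-- The stacked space `ℂⁿ⁺ᵐ ∋ (x, y)` with its Euclidean norm. -/
abbrev Stacked (n m : ℕ) : Type :=
  WithLp 2 (EuclideanSpace ℂ (Fin n) × EuclideanSpace ℂ (Fin m))

/-- The stacked vector `(x, y)`. -/
abbrev stack {n m : ℕ} (x : EuclideanSpace ℂ (Fin n)) (y : EuclideanSpace ℂ (Fin m)) :
    Stacked n m :=
  WithLp.toLp 2 (x, y)

/-- The measurement map `x ↦ A* x`, where the columns of `A` are the sampling vectors. -/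
def meas {n m : ℕ} (A : Matrix (Fin n) (Fin m) ℂ) :
    EuclideanSpace ℂ (Fin n) →ₗ[ℂ] EuclideanSpace ℂ (Fin m) :=
  Matrix.toEuclideanLin Aᴴ

/-- The graph `{(x, y) | A* x = y}`. -/
def graphSet {n m : ℕ} (A : Matrix (Fin n) (Fin m) ℂ) : Submodule ℂ (Stacked n m) where
  carrier := {z | meas A z.fst = z.snd}
  add_mem' := by
    intro a b ha hb
    simp only [Set.mem_ofPred_eq] at ha hb ⊢
    simp [ha, hb]
  zero_mem' := by simp
  smul_mem' := by
    intro c a ha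
    simp only [Set.mem_ofPred_eq] at ha ⊢
    simp [ha]

/-- The orthogonal projection onto the graph. -/
def graphProj {n m : ℕ} (A : Matrix (Fin n) (Fin m) ℂ) : Stacked n m →L[ℂ] Stacked n m :=
  (graphSet A).starProjection

/-- The robust graph projection `t I + (1 - t) Π`. -/
def robustProj {n m : ℕ} (A : Matrix (Fin n) (Fin m) ℂ) (t : ℝ) (z : Stacked n m) :
    Stacked n m :=
  (t : ℂ) • z + ((1 - t : ℝ) : ℂ) • graphProj A z

/-- The phase `z / |z|` of a complex number, equal to `0` at `z = 0`. -/
def phase (z : ℂ) : ℂ := z / (‖z‖ : ℂ)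

/-- The proximity operator of the indicator function of `{y | |y| = b}`, that is the elementwise
product `b ∘ y / |y|`, with `0 / |0| = 0`. -/
def proxF {m : ℕ} (b : Fin m → ℝ) (y : EuclideanSpace ℂ (Fin m)) : EuclideanSpace ℂ (Fin m) :=
  WithLp.toLp 2 fun i => (b i : ℂ) * phase (y i)

/-- The proximity operator of `φ(x, y) = f(y) + g(x)` with `g = 0`: the identity in `x`. -/
def proxPhi {n m : ℕ} (b : Fin m → ℝ) (z : Stacked n m) : Stacked n m :=
  stack z.fst (proxF b z.snd)

/-- The primal variables `x, y` and the dual variables `lam, nu` of the splitting iteration. -/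
structure State (n m : ℕ) where
  x : EuclideanSpace ℂ (Fin n)
  y : EuclideanSpace ℂ (Fin m)
  lam : EuclideanSpace ℂ (Fin n)
  nu : EuclideanSpace ℂ (Fin m)

/-- One iteration of robust graph projection splitting without prior (`g = 0`). -/
def rgpsStep {n m : ℕ} (A : Matrix (Fin n) (Fin m) ℂ) (b : Fin m → ℝ) (t : ℝ)
    (s : State n m) : State n m :=
  let h := robustProj A t (stack (s.x - s.lam) (s.y - s.nu))
  let p := proxPhi b (stack (h.fst + s.lam) (h.snd + s.nu))
  { x := p.fst
    y := p.snd
    lam := s.lam + h.fst - p.fst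
    nu := s.nu + h.snd - p.snd }

/-- The Douglas-Rachford variable `(lam + x, nu + y)` attached to a state. -/
def State.dr {n m : ℕ} (s : State n m) : Stacked n m := stack (s.lam + s.x) (s.nu + s.y)

/-- The iteration map of RGPS in the single Douglas-Rachford variable. -/
def rgpsDRStep {n m : ℕ} (A : Matrix (Fin n) (Fin m) ℂ) (b : Fin m → ℝ) (t : ℝ)
    (z : Stacked n m) : Stacked n m :=
  z + robustProj A t ((2 : ℂ) • proxPhi b z - z) - proxPhi b z

/-- The distance up to a global phase, `min_{|α| = 1} ‖u - α v‖`. -/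
def phaseDist {E : Type*} [NormedAddCommGroup E] [Module ℂ E] (u v : E) : ℝ :=
  ⨅ α : Circle, ‖u - (α : ℂ) • v‖

/-- The set `{α z | |α| = 1}`. -/
def phaseOrbit {n m : ℕ} (z : Stacked n m) : Set (Stacked n m) :=
  {w | ∃ α : Circle, w = (α : ℂ) • z}

/-- Uniqueness of magnitude retrieval: the vectors `x` such that each `a_i* x` has the same phase
as `a_i* xs` up to sign are the nonzero real multiples of `xs`. -/
def MagnitudeRetrievalUnique {n m : ℕ} (A : Matrix (Fin n) (Fin m) ℂ)
    (xs : EuclideanSpace ℂ (Fin n)) : Prop :=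
  ∀ x : EuclideanSpace ℂ (Fin n),
    (∀ i, phase (meas A x i) = phase (meas A xs i) ∨
      phase (meas A x i) = -phase (meas A xs i)) →
    ∃ c : ℝ, c ≠ 0 ∧ x = (c : ℂ) • xs

/-- `C = (L⁻¹, L⁻¹ A)`, for a factor `L` of `I + A A* = L L*`. -/
def matC {n m : ℕ} (A : Matrix (Fin n) (Fin m) ℂ) (L : Matrix (Fin n) (Fin n) ℂ) :
    Matrix (Fin n) (Fin n ⊕ Fin m) ℂ :=
  Matrix.fromCols L⁻¹ (L⁻¹ * A)

/-- `B = C Ω`, where `Ω` is the diagonal matrix with entries `ωx` and the phases of `A* xs`. -/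
def matB {n m : ℕ} (A : Matrix (Fin n) (Fin m) ℂ) (L : Matrix (Fin n) (Fin n) ℂ)
    (xs : EuclideanSpace ℂ (Fin n)) (ωx : Fin n → ℂ) : Matrix (Fin n) (Fin n ⊕ Fin m) ℂ :=
  matC A L * Matrix.diagonal (Sum.elim ωx fun i => phase (meas A xs i))

/-- The real form of `B`: its real part stacked on its imaginary part. -/
def realB {n m : ℕ} (A : Matrix (Fin n) (Fin m) ℂ) (L : Matrix (Fin n) (Fin n) ℂ)
    (xs : EuclideanSpace ℂ (Fin n)) (ωx : Fin n → ℂ) :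
    Matrix (Fin n ⊕ Fin n) (Fin n ⊕ Fin m) ℝ :=
  Matrix.fromRows ((matB A L xs ωx).map Complex.re) ((matB A L xs ωx).map Complex.im)

/-- The second largest singular value of the real form of `B` (Mathlib counts from zero). -/
def sigma2 {n m : ℕ} (A : Matrix (Fin n) (Fin m) ℂ) (L : Matrix (Fin n) (Fin n) ℂ)
    (xs : EuclideanSpace ℂ (Fin n)) (ωx : Fin n → ℂ) : ℝ :=
  (Matrix.toEuclideanLin (realB A L xs ωx)).singularValues 1

/-- The smallest nonzero singular value of `A`. -/
def sMin {n m : ℕ} (A : Matrix (Fin n) (Fin m) ℂ) : ℝ :=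
  sInf {s : ℝ | s ≠ 0 ∧ ∃ i : ℕ, s = (Matrix.toEuclideanLin A).singularValues i}

/-- `δ₁ = 1 / √(1 + s_min(A)²)`. -/
def delta1 {n m : ℕ} (A : Matrix (Fin n) (Fin m) ℂ) : ℝ := 1 / √(1 + sMin A ^ 2)

/-- `β̃`, where `β̃² = max {σ₂² + (1 - σ₂²) δ₁², σ₂²}`. -/
def betaTilde {n m : ℕ} (A : Matrix (Fin n) (Fin m) ℂ) (L : Matrix (Fin n) (Fin n) ℂ)
    (xs : EuclideanSpace ℂ (Fin n)) (ωx : Fin n → ℂ) : ℝ :=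
  √(max (sigma2 A L xs ωx ^ 2 + (1 - sigma2 A L xs ωx ^ 2) * delta1 A ^ 2)
    (sigma2 A L xs ωx ^ 2))

/-- `t_max = 2 (1 - β̃²) / (2 - β̃²)` as a function of `β̃`. -/
def tMax (β : ℝ) : ℝ := 2 * (1 - β ^ 2) / (2 - β ^ 2)

end PhaseRetrieval

end

/-!
The iteration map `T` commutes with global phases and fixes `z♮`, so it suffices to bound its
real derivative at `z♮` on the slice real-orthogonal to `i z♮`. With `q` the part of `v` tangent to
the torus `|y| = b` and `p = v - q` its normal part, the derivative is
`v ↦ p + (t I + (1 - t) Π) (q - p)`. Pythagoras on the graph and its complement, together with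
convexity of the square, shows that its squared norm is at most
`‖v‖² - (1 - t) ‖Πᗮ q‖² - t ‖p‖²`, so it strictly decreases norms except on tangent vectors lying
in the graph. Such a vector is a real multiple of `i z♮` by uniqueness of magnitude retrieval, and
the slice contains no nonzero one; compactness of the unit sphere of the slice gives the rate.

Likewise `B` is a coisometry, and the real vectors whose norm it preserves form a line by
uniqueness of magnitude retrieval, so `σ₂ < 1`.
-/

namespace PhaseRetrieval

section PhaseDist

variable {E : Type*} [NormedAddCommGroup E]

theorem phaseDist_le [Module ℂ E] (u v : E) (α : Circle) : phaseDist u v ≤ ‖u - (α : ℂ) • v‖ :=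
  ciInf_le (f := fun α : Circle => ‖u - (α : ℂ) • v‖)
    ⟨0, Set.forall_mem_range.2 fun _ => norm_nonneg _⟩ α

theorem phaseDist_nonneg [Module ℂ E] (u v : E) : 0 ≤ phaseDist u v :=
  Real.iInf_nonneg fun _ => norm_nonneg _

theorem phaseDist_fst_le {F : Type*} [NormedAddCommGroup F] [Module ℂ E] [Module ℂ F]
    (u v : WithLp 2 (E × F)) : phaseDist u.fst v.fst ≤ phaseDist u v :=
  le_ciInf fun α => (phaseDist_le _ _ α).trans (WithLp.norm_fst_le _ (u - (α : ℂ) • v))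

theorem norm_circle_smul [NormedSpace ℂ E] (α : Circle) (v : E) : ‖(α : ℂ) • v‖ = ‖v‖ := by
  rw [norm_smul, Circle.norm_coe, one_mul]

variable [InnerProductSpace ℂ E]

/-- The tangent slice at `z` to the action of the phases: the vectors real-orthogonal to the
tangent vector `i z` of the orbit of `z`. -/
noncomputable def phaseSlice (z : E) : Submodule ℝ E :=
  (Complex.imCLM ∘L (innerSL ℂ z).restrictScalars ℝ).ker

theorem mem_phaseSlice {z v : E} : v ∈ phaseSlice z ↔ (inner ℂ z v).im = 0 :=
  Iff.rfl

theorem real_smul_I_smul_eq_zero_of_mem_phaseSlice {z : E} {c : ℝ}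
    (h : (c * Complex.I) • z ∈ phaseSlice z) : (c * Complex.I) • z = 0 := by
  have hc : c * ‖z‖ ^ 2 = 0 := by
    have hinner : inner ℂ z ((c * Complex.I) • z) = ((c * ‖z‖ ^ 2 : ℝ) : ℂ) * Complex.I := by
      rw [inner_smul_right, inner_self_eq_norm_sq_to_K, RCLike.ofReal_eq_complex_ofReal]
      push_cast
      ring
    rwa [mem_phaseSlice, hinner, Complex.im_ofReal_mul, Complex.I_im, mul_one] at h
  rcases mul_eq_zero.1 hc with rfl | hz
  · simp
  · simp [show z = 0 by simpa using hz]

/-- The best phase is the one that makes `⟪z, u⟫` a nonnegative real number. -/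
theorem exists_eq_smul_add_mem_phaseSlice (u z : E) :
    ∃ α : Circle, ∃ v ∈ phaseSlice z, u = (α : ℂ) • (z + v) ∧ ‖v‖ = phaseDist u z := by
  obtain ⟨c, hc, hcu⟩ := Complex.exists_norm_eq_mul_self (inner ℂ z u)
  obtain ⟨β, hβ⟩ : ∃ β : Circle, (β : ℂ) * inner ℂ z u = ‖(inner ℂ z u : ℂ)‖ :=
    ⟨⟨c, mem_sphere_zero_iff_norm.2 hc⟩, hcu.symm⟩
  have hu : ((β⁻¹ : Circle) : ℂ) • (z + ((β : ℂ) • u - z)) = u := by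
    rw [add_sub_cancel, smul_smul, ← Circle.coe_mul, inv_mul_cancel, Circle.coe_one, one_smul]
  refine ⟨β⁻¹, (β : ℂ) • u - z, ?_, hu.symm, le_antisymm (le_ciInf fun α => ?_) ?_⟩
  · rw [mem_phaseSlice, inner_sub_right, inner_smul_right, hβ, inner_self_eq_norm_sq_to_K,
      RCLike.ofReal_eq_complex_ofReal, ← Complex.ofReal_pow, ← Complex.ofReal_sub,
      Complex.ofReal_im]
  · have hre : (inner ℂ u ((α : ℂ) • z)).re ≤ (inner ℂ ((β : ℂ) • u) z).re :=
      calc (inner ℂ u ((α : ℂ) • z)).re ≤ ‖(inner ℂ u ((α : ℂ) • z) : ℂ)‖ := Complex.re_le_norm _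
        _ = ‖(inner ℂ z u : ℂ)‖ := by
            rw [inner_smul_right, norm_mul, Circle.norm_coe, one_mul, norm_inner_symm]
        _ = (inner ℂ ((β : ℂ) • u) z).re := by
            rw [← inner_conj_symm ((β : ℂ) • u) z, inner_smul_right, hβ, Complex.conj_ofReal,
              Complex.ofReal_re]
    refine le_of_sq_le_sq ?_ (norm_nonneg _)
    rw [@norm_sub_sq ℂ, @norm_sub_sq ℂ, norm_circle_smul, norm_circle_smul,
      RCLike.re_eq_complex_re]
    linarith
  · refine (phaseDist_le _ _ β⁻¹).trans_eq ?_
    conv_lhs => rw [← hu, ← smul_sub, norm_circle_smul, add_sub_cancel_left]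

theorem phaseDist_eq_zero_iff {u z : E} : phaseDist u z = 0 ↔ ∃ α : Circle, u = (α : ℂ) • z := by
  constructor
  · intro h
    obtain ⟨α, v, -, hu, hv⟩ := exists_eq_smul_add_mem_phaseSlice u z
    exact ⟨α, by rw [hu, norm_eq_zero.1 (hv.trans h), add_zero]⟩
  · rintro ⟨α, rfl⟩
    exact le_antisymm ((phaseDist_le _ _ α).trans_eq (by simp)) (phaseDist_nonneg _ _)

end PhaseDist

section LocalContraction

theorem opNorm_lt_one_of_forall_norm_lt {E F : Type*} [NormedAddCommGroup E] [NormedSpace ℝ E]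
    [FiniteDimensional ℝ E] [NormedAddCommGroup F] [NormedSpace ℝ F] (M : E →L[ℝ] F)
    (h : ∀ v, v ≠ 0 → ‖M v‖ < ‖v‖) : ‖M‖ < 1 := by
  have : ProperSpace E := FiniteDimensional.proper ℝ E
  cases subsingleton_or_nontrivial E
  · simp [Subsingleton.elim M 0]
  obtain ⟨v₀, hv₀, hmax⟩ := (isCompact_sphere (0 : E) 1).exists_isMaxOn
    (NormedSpace.sphere_nonempty.2 zero_le_one) (f := fun v => ‖M v‖) (by fun_prop)
  have hnorm : ‖v₀‖ = 1 := mem_sphere_zero_iff_norm.1 hv₀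
  calc ‖M‖ ≤ ‖M v₀‖ := M.opNorm_le_of_unit_norm (norm_nonneg _) fun v hv =>
        hmax (mem_sphere_zero_iff_norm.2 hv)
    _ < ‖v₀‖ := h v₀ (norm_ne_zero_iff.1 (by simp [hnorm]))
    _ = 1 := hnorm

variable {E : Type*} [NormedAddCommGroup E] [InnerProductSpace ℂ E] {T : E → E} {z : E}

theorem exists_phaseDist_apply_le_mul [FiniteDimensional ℂ E] {M : E →L[ℝ] E}
    (hT : ∀ (α : Circle) w, T ((α : ℂ) • w) = (α : ℂ) • T w) (hz : T z = z)
    (hM : HasFDerivAt T M z) (hlt : ∀ v ∈ phaseSlice z, v ≠ 0 → ‖M v‖ < ‖v‖) :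
    ∃ γ ∈ Set.Ioo (0 : ℝ) 1, ∃ r > 0, ∀ w, phaseDist w z < r →
      phaseDist (T w) z ≤ γ * phaseDist w z := by
  have : FiniteDimensional ℝ E := FiniteDimensional.complexToReal E
  set g := ‖M ∘L (phaseSlice z).subtypeL‖
  have hg0 : 0 ≤ g := norm_nonneg (M ∘L (phaseSlice z).subtypeL)
  have hg1 : g < 1 := opNorm_lt_one_of_forall_norm_lt _ fun v hv =>
    hlt v v.2 (by simpa using hv)
  have hMle : ∀ v ∈ phaseSlice z, ‖M v‖ ≤ g * ‖v‖ := fun v hv =>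
    (M ∘L (phaseSlice z).subtypeL).le_opNorm ⟨v, hv⟩
  obtain ⟨r, hr, hlin⟩ := Metric.eventually_nhds_iff.1
    (hM.isLittleO.def (show 0 < (1 - g) / 2 by linarith))
  refine ⟨(1 + g) / 2, ⟨by linarith, by linarith⟩, r, hr, fun w hw => ?_⟩
  obtain ⟨α, v, hv, rfl, hvnorm⟩ := exists_eq_smul_add_mem_phaseSlice w z
  rw [← hvnorm] at hw ⊢
  have hrem : ‖T (z + v) - z - M v‖ ≤ (1 - g) / 2 * ‖v‖ := by
    simpa [hz] using hlin (y := z + v) (by simpa [dist_eq_norm] using hw)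
  calc phaseDist (T ((α : ℂ) • (z + v))) z
      ≤ ‖T ((α : ℂ) • (z + v)) - (α : ℂ) • z‖ := phaseDist_le _ _ α
    _ = ‖T (z + v) - z - M v + M v‖ := by
        rw [hT, ← smul_sub, norm_circle_smul, sub_add_cancel]
    _ ≤ (1 - g) / 2 * ‖v‖ + g * ‖v‖ := norm_add_le_of_le hrem (hMle v hv)
    _ = (1 + g) / 2 * ‖v‖ := by ring

theorem apply_eq_self_iff_of_phaseDist_le {γ r : ℝ}
    (hT : ∀ (α : Circle) w, T ((α : ℂ) • w) = (α : ℂ) • T w) (hz : T z = z) (hγ : γ < 1)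
    (hstep : ∀ w, phaseDist w z < r → phaseDist (T w) z ≤ γ * phaseDist w z) {w : E}
    (hw : phaseDist w z < r) : T w = w ↔ ∃ α : Circle, w = (α : ℂ) • z := by
  constructor
  · intro hfix
    have hle := hstep w hw
    rw [hfix] at hle
    exact phaseDist_eq_zero_iff.1 (by nlinarith [phaseDist_nonneg w z])
  · rintro ⟨α, rfl⟩
    rw [hT, hz]

theorem le_pow_mul_of_lt_imp_le_mul {d : ℕ → ℝ} {γ r : ℝ} (hγ0 : 0 ≤ γ) (hγ1 : γ ≤ 1)
    (hd : 0 ≤ d 0) (h0 : d 0 < r) (hstep : ∀ k, d k < r → d (k + 1) ≤ γ * d k) (k : ℕ) :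
    d k ≤ γ ^ k * d 0 := by
  induction k with
  | zero => simp
  | succ k ih =>
    have hk : d k < r := (ih.trans (mul_le_of_le_one_left hd (pow_le_one₀ hγ0 hγ1))).trans_lt h0
    calc d (k + 1) ≤ γ * d k := hstep k hk
      _ ≤ γ * (γ ^ k * d 0) := by gcongr
      _ = γ ^ (k + 1) * d 0 := by ring

end LocalContraction

section Linearization

/-- Pythagoras on `K` and `Kᗮ`, and convexity of the square on `Kᗮ`. -/
theorem norm_sq_relaxed_reflection_add_le {𝕜 E : Type*} [RCLike 𝕜] [NormedAddCommGroup E]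
    [InnerProductSpace 𝕜 E] (K : Submodule 𝕜 E) [K.HasOrthogonalProjection] {t : ℝ}
    (ht0 : 0 ≤ t) (ht1 : t ≤ 1) (q p : E) :
    ‖p + ((t : 𝕜) • (q - p) + ((1 - t : ℝ) : 𝕜) • K.starProjection (q - p))‖ ^ 2
        + (1 - t) * ‖Kᗮ.starProjection q‖ ^ 2 + t * ‖p‖ ^ 2 ≤ ‖q‖ ^ 2 + ‖p‖ ^ 2 := by
  set a := Kᗮ.starProjection q with ha
  set e := Kᗮ.starProjection p with he
  have hdecomp : p + ((t : 𝕜) • (q - p) + ((1 - t : ℝ) : 𝕜) • K.starProjection (q - p))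
      = K.starProjection q + ((t : 𝕜) • a + ((1 - t : ℝ) : 𝕜) • e) := by
    rw [ha, he, K.starProjection_orthogonal_val, K.starProjection_orthogonal_val, map_sub]
    push_cast
    module
  have hpyth : ‖K.starProjection q + ((t : 𝕜) • a + ((1 - t : ℝ) : 𝕜) • e)‖ ^ 2
      = ‖K.starProjection q‖ ^ 2 + ‖(t : 𝕜) • a + ((1 - t : ℝ) : 𝕜) • e‖ ^ 2 := by
    simp only [sq]
    refine norm_add_sq_eq_norm_sq_add_norm_sq_of_inner_eq_zero (𝕜 := 𝕜) _ _ ?_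
    exact K.inner_right_of_mem_orthogonal (K.starProjection_apply_mem q)
      (add_mem (Submodule.smul_mem _ _ (Kᗮ.starProjection_apply_mem q))
        (Submodule.smul_mem _ _ (Kᗮ.starProjection_apply_mem p)))
  have hconvex : ‖(t : 𝕜) • a + ((1 - t : ℝ) : 𝕜) • e‖ ^ 2 ≤ t * ‖a‖ ^ 2 + (1 - t) * ‖e‖ ^ 2 :=
    calc ‖(t : 𝕜) • a + ((1 - t : ℝ) : 𝕜) • e‖ ^ 2 ≤ (t * ‖a‖ + (1 - t) * ‖e‖) ^ 2 := by
          gcongr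
          refine (norm_add_le _ _).trans_eq ?_
          rw [norm_smul, norm_smul, RCLike.norm_ofReal, RCLike.norm_ofReal, abs_of_nonneg ht0,
            abs_of_nonneg (sub_nonneg.2 ht1)]
      _ ≤ t * ‖a‖ ^ 2 + (1 - t) * ‖e‖ ^ 2 :=
          (convexOn_pow 2).2 (norm_nonneg a) (norm_nonneg e) ht0 (sub_nonneg.2 ht1) (by ring)
  have hq : ‖q‖ ^ 2 = ‖K.starProjection q‖ ^ 2 + ‖a‖ ^ 2 :=
    K.norm_sq_eq_add_norm_sq_starProjection q
  have hep : (1 - t) * ‖e‖ ^ 2 ≤ (1 - t) * ‖p‖ ^ 2 := by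
    have := Kᗮ.norm_starProjection_apply_le p
    have := sub_nonneg.2 ht1
    gcongr
  rw [hdecomp, hpyth]
  linarith

theorem hasFDerivAt_normalize {E : Type*} [NormedAddCommGroup E] [InnerProductSpace ℝ E] {y : E}
    (hy : y ≠ 0) :
    HasFDerivAt NormedSpace.normalize (‖y‖⁻¹ • (ℝ ∙ y)ᗮ.starProjection) y := by
  have hn : ‖y‖ ≠ 0 := norm_ne_zero_iff.2 hy
  have hnorm : HasFDerivAt (fun z : E => ‖z‖) (‖y‖⁻¹ • innerSL ℝ y) y := by
    have := (hasStrictFDerivAt_norm_sq y).hasFDerivAt.sqrt (by positivity)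
    simp only [Real.sqrt_sq (norm_nonneg _)] at this
    refine this.congr_fderiv ?_
    ext v
    simp only [one_div, mul_inv_rev, smul_apply, coe_innerSL_apply, nsmul_eq_mul, Nat.cast_ofNat,
      smul_eq_mul]
    field_simp
  refine (((hasDerivAt_inv hn).comp_hasFDerivAt y hnorm).smul (hasFDerivAt_id y)).congr_fderiv ?_
  ext v
  simp only [Function.comp_apply, smul_smul, neg_mul, neg_smul, id_eq, add_apply, smul_apply,
    ContinuousLinearMap.id_apply, ContinuousLinearMap.smulRight_apply, neg_apply,
    coe_innerSL_apply, smul_eq_mul, Submodule.starProjection_orthogonal_val,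
    Submodule.starProjection_singleton, Real.ringHom_apply, smul_sub]
  field_simp
  module

end Linearization

section Phase

theorem phase_eq_normalize (z : ℂ) : phase z = NormedSpace.normalize z := by
  rw [phase, NormedSpace.normalize, Complex.real_smul, Complex.ofReal_inv, div_eq_inv_mul]

theorem norm_phase {z : ℂ} (h : z ≠ 0) : ‖phase z‖ = 1 := by
  rw [phase_eq_normalize, NormedSpace.norm_normalize_eq_one_iff.2 h]

theorem norm_mul_phase (z : ℂ) : ‖z‖ * phase z = z := by
  rw [phase_eq_normalize, ← Complex.real_smul, NormedSpace.norm_smul_normalize]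

theorem phase_circle_mul (α : Circle) (z : ℂ) : phase (α * z) = α * phase z := by
  rw [phase, norm_mul, Circle.norm_coe, one_mul, mul_div_assoc, phase]

theorem phase_ofReal_mul {r : ℝ} (hr : r ≠ 0) (z : ℂ) :
    phase (r * z) = phase z ∨ phase (r * z) = -phase z := by
  simp only [phase_eq_normalize, ← Complex.real_smul]
  rcases lt_or_gt_of_ne hr with h | h
  · exact .inr (NormedSpace.normalize_smul_of_neg h z)
  · exact .inl (NormedSpace.normalize_smul_of_pos h z)

end Phase

section MagnitudeRetrieval

variable {n m : ℕ} {A : Matrix (Fin n) (Fin m) ℂ} {xs : EuclideanSpace ℂ (Fin n)}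

/-- Measurements of `x` may vanish where those of `xs` do not; adding a generic real multiple of
`xs` to `x` removes these zeros. -/
theorem MagnitudeRetrievalUnique.eq_smul (hmag : MagnitudeRetrievalUnique A xs)
    {x : EuclideanSpace ℂ (Fin n)} (hx : ∀ i, ∃ r : ℝ, meas A x i = r * meas A xs i) :
    ∃ c : ℝ, x = (c : ℂ) • xs := by
  choose r hr using hx
  obtain ⟨s, hs⟩ := (Set.finite_range fun i => -r i).infinite_compl.nonempty
  obtain ⟨c, -, hc⟩ := hmag (x + (s : ℂ) • xs) fun i => by
    have hne : r i + s ≠ 0 := fun h => hs ⟨i, by linarith⟩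
    have hmeas : meas A (x + (s : ℂ) • xs) i = ((r i + s : ℝ) : ℂ) * meas A xs i := by
      rw [map_add, map_smul, PiLp.add_apply, PiLp.smul_apply, hr, smul_eq_mul]
      push_cast
      ring
    rw [hmeas]
    exact phase_ofReal_mul hne _
  exact ⟨c - s, by rw [Complex.ofReal_sub, sub_smul, ← hc, add_sub_cancel_right]⟩

theorem MagnitudeRetrievalUnique.matrix_ne_zero (hmag : MagnitudeRetrievalUnique A xs)
    (hn : 0 < n) : A ≠ 0 := by
  rintro rfl
  have hall : ∀ x, ∃ c : ℝ, x = (c : ℂ) • xs := fun x =>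
    hmag.eq_smul fun i => ⟨0, by simp [meas]⟩
  obtain ⟨c, hc0, hc⟩ := hmag 0 fun i => by simp [meas, phase]
  have hxs : xs = 0 := (smul_eq_zero.1 hc.symm).resolve_left (mod_cast hc0)
  obtain ⟨d, hd⟩ := hall (EuclideanSpace.single ⟨0, hn⟩ 1)
  simp [hxs] at hd

end MagnitudeRetrieval

section SingularValues

open Matrix (toEuclideanLin)

theorem norm_sq_add_norm_sub_adjoint_sq {𝕜 E F : Type*} [RCLike 𝕜] [NormedAddCommGroup E]
    [InnerProductSpace 𝕜 E] [FiniteDimensional 𝕜 E] [NormedAddCommGroup F]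
    [InnerProductSpace 𝕜 F] [FiniteDimensional 𝕜 F] {S : E →ₗ[𝕜] F}
    (hS : S ∘ₗ S.adjoint = LinearMap.id) (u : E) :
    ‖S u‖ ^ 2 + ‖u - S.adjoint (S u)‖ ^ 2 = ‖u‖ ^ 2 := by
  have horth : inner 𝕜 (S.adjoint (S u)) (u - S.adjoint (S u)) = 0 := by
    rw [LinearMap.adjoint_inner_left, map_sub, ← S.comp_apply, hS, LinearMap.id_apply, sub_self,
      inner_zero_right]
  have hnorm : ‖S.adjoint (S u)‖ ^ 2 = ‖S u‖ ^ 2 := by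
    rw [← inner_self_eq_norm_sq (𝕜 := 𝕜), LinearMap.adjoint_inner_left, ← S.comp_apply, hS,
      LinearMap.id_apply, inner_self_eq_norm_sq]
  have hpyth := norm_add_sq_eq_norm_sq_add_norm_sq_of_inner_eq_zero _ _ horth
  rw [add_sub_cancel] at hpyth
  linarith

theorem norm_sq_add_norm_sub_conjTranspose_sq {𝕜 ι κ : Type*} [RCLike 𝕜] [Fintype ι] [DecidableEq ι]
    [Fintype κ] [DecidableEq κ] {B : Matrix ι κ 𝕜} (hB : B * Bᴴ = 1) (u : EuclideanSpace 𝕜 κ) :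
    ‖toEuclideanLin B u‖ ^ 2
      + ‖u - toEuclideanLin Bᴴ (toEuclideanLin B u)‖ ^ 2 = ‖u‖ ^ 2 := by
  have hcoisometry : toEuclideanLin B ∘ₗ (toEuclideanLin B).adjoint = LinearMap.id := by
    rw [← Matrix.toEuclideanLin_conjTranspose_eq_adjoint, ← Matrix.toLpLin_mul_same, hB,
      Matrix.toLpLin_one]
  rw [Matrix.toEuclideanLin_conjTranspose_eq_adjoint,
    norm_sq_add_norm_sub_adjoint_sq hcoisometry]

theorem norm_apply_eigenvectorBasis_adjoint_comp_self {𝕜 E F : Type*} [RCLike 𝕜]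
    [NormedAddCommGroup E] [InnerProductSpace 𝕜 E] [FiniteDimensional 𝕜 E] [NormedAddCommGroup F]
    [InnerProductSpace 𝕜 F] [FiniteDimensional 𝕜 F] (T : E →ₗ[𝕜] F) {d : ℕ}
    (hd : Module.finrank 𝕜 E = d) (i : Fin d) :
    ‖T (T.isSymmetric_adjoint_comp_self.eigenvectorBasis hd i)‖ = T.singularValues i := by
  have happly := T.isSymmetric_adjoint_comp_self.apply_eigenvectorBasis hd i
  refine (sq_eq_sq₀ (norm_nonneg _) (T.singularValues_nonneg i)).1 ?_
  rw [T.sq_singularValues_fin hd i, ← inner_self_eq_norm_sq (𝕜 := 𝕜),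
    ← LinearMap.adjoint_inner_right, ← LinearMap.comp_apply, happly, inner_smul_right,
    inner_self_eq_norm_sq_to_K, OrthonormalBasis.norm_eq_one]
  simp

theorem singularValues_lt_one {𝕜 E F : Type*} [RCLike 𝕜] [NormedAddCommGroup E]
    [InnerProductSpace 𝕜 E] [FiniteDimensional 𝕜 E] [NormedAddCommGroup F]
    [InnerProductSpace 𝕜 F] [FiniteDimensional 𝕜 F] (T : E →ₗ[𝕜] F) (W : Submodule 𝕜 E) {k : ℕ}
    (hW : Module.finrank 𝕜 W ≤ k) (hle : ∀ v, ‖T v‖ ≤ ‖v‖) (hmem : ∀ v, ‖T v‖ = ‖v‖ → v ∈ W) :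
    T.singularValues k < 1 := by
  by_contra! hk
  have hkd : k < Module.finrank 𝕜 E := by
    by_contra! hd
    exact one_pos.not_ge (hk.trans_eq (T.singularValues_of_finrank_le hd))
  set e := T.isSymmetric_adjoint_comp_self.eigenvectorBasis rfl with he
  have heW : ∀ i : Fin (k + 1), e (i.castLE hkd) ∈ W := fun i =>
    hmem _ <| (hle _).antisymm <| by
      rw [e.norm_eq_one, he, norm_apply_eigenvectorBasis_adjoint_comp_self]
      exact hk.trans (T.singularValues_antitone (Nat.lt_succ_iff.1 i.2))
  have hli : LinearIndependent 𝕜 fun i : Fin (k + 1) => (⟨e (i.castLE hkd), heW i⟩ : W) :=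
    .of_comp W.subtype
      (e.orthonormal.linearIndependent.comp _ (Fin.castLE_injective hkd))
  have hcard := hli.fintype_card_le_finrank
  rw [Fintype.card_fin] at hcard
  lia

theorem norm_toLp_ofReal {ι : Type*} [Fintype ι] (w : EuclideanSpace ℝ ι) :
    ‖(WithLp.toLp 2 fun i => (w i : ℂ) : EuclideanSpace ℂ ι)‖ = ‖w‖ := by
  simp [EuclideanSpace.norm_eq]

theorem norm_toEuclideanLin_fromRows_re_im {ι κ : Type*} [Fintype ι] [Fintype κ]
    [DecidableEq κ] (B : Matrix ι κ ℂ) (w : EuclideanSpace ℝ κ) :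
    ‖toEuclideanLin (Matrix.fromRows (B.map Complex.re) (B.map Complex.im)) w‖
      = ‖toEuclideanLin B (WithLp.toLp 2 fun j => (w j : ℂ))‖ := by
  rw [EuclideanSpace.norm_eq, EuclideanSpace.norm_eq, Fintype.sum_sum_type,
    ← Finset.sum_add_distrib]
  congr 1
  refine Finset.sum_congr rfl fun i _ => ?_
  rw [← Complex.normSq_eq_norm_sq, Complex.normSq_apply]
  simp [Matrix.toLpLin_apply, Matrix.mulVec, dotProduct, sq]

variable {n m : ℕ} {A : Matrix (Fin n) (Fin m) ℂ} {L : Matrix (Fin n) (Fin n) ℂ}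
  {xs : EuclideanSpace ℂ (Fin n)} {ωx : Fin n → ℂ}

open scoped ComplexOrder in
theorem matC_mul_conjTranspose (hL : L * Lᴴ = 1 + A * Aᴴ) : matC A L * (matC A L)ᴴ = 1 := by
  have hpos : (L * Lᴴ).PosDef :=
    hL ▸ Matrix.PosDef.one.add_posSemidef (Matrix.posSemidef_self_mul_conjTranspose A)
  have hunit : IsUnit L.det := by
    have := (Matrix.isUnit_iff_isUnit_det _).1 hpos.isUnit
    rw [Matrix.det_mul] at this
    exact isUnit_of_mul_isUnit_left this
  have hunit' : IsUnit Lᴴ.det := Matrix.det_conjTranspose L ▸ hunit.star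
  calc matC A L * (matC A L)ᴴ = L⁻¹ * (1 + A * Aᴴ) * (Lᴴ)⁻¹ := by
        rw [matC, Matrix.conjTranspose_fromCols_eq_fromRows_conjTranspose,
          Matrix.fromCols_mul_fromRows, Matrix.conjTranspose_mul, Matrix.conjTranspose_nonsing_inv]
        simp only [Matrix.mul_add, Matrix.add_mul, Matrix.mul_one, Matrix.mul_assoc]
    _ = 1 := by
        rw [← hL, ← Matrix.mul_assoc, Matrix.nonsing_inv_mul _ hunit, Matrix.one_mul,
          Matrix.mul_nonsing_inv _ hunit']

theorem matB_mul_conjTranspose (hL : L * Lᴴ = 1 + A * Aᴴ) (h0 : ∀ i, meas A xs i ≠ 0)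
    (hω : ∀ j, ‖ωx j‖ = 1) : matB A L xs ωx * (matB A L xs ωx)ᴴ = 1 := by
  have hunitary : Matrix.diagonal (Sum.elim ωx fun i => phase (meas A xs i))
      * (Matrix.diagonal (Sum.elim ωx fun i => phase (meas A xs i)))ᴴ = 1 := by
    rw [Matrix.diagonal_conjTranspose, Matrix.diagonal_mul_diagonal, ← Matrix.diagonal_one]
    congr 1
    ext (j | i)
    · simp [Complex.mul_conj, Complex.normSq_eq_norm_sq, hω]
    · simp [Complex.mul_conj, Complex.normSq_eq_norm_sq, norm_phase (h0 i)]
  rw [matB, Matrix.conjTranspose_mul, Matrix.mul_assoc, ← Matrix.mul_assoc (Matrix.diagonal _),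
    hunitary, Matrix.one_mul, matC_mul_conjTranspose hL]

theorem toEuclideanLin_conjTranspose_matB_apply (v : EuclideanSpace ℂ (Fin n)) (i : Fin n ⊕ Fin m) :
    toEuclideanLin (matB A L xs ωx)ᴴ v i
      = star (Sum.elim ωx (fun i => phase (meas A xs i)) i)
        * Sum.elim (toEuclideanLin (L⁻¹)ᴴ v)
          (meas A (toEuclideanLin (L⁻¹)ᴴ v)) i := by
  rw [matB, Matrix.conjTranspose_mul, Matrix.diagonal_conjTranspose, Matrix.toLpLin_apply,
    ← Matrix.mulVec_mulVec, PiLp.toLp_apply, Matrix.mulVec_diagonal, Pi.star_apply, matC,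
    Matrix.conjTranspose_fromCols_eq_fromRows_conjTranspose, Matrix.fromRows_mulVec]
  cases i <;> simp [meas, Matrix.toLpLin_apply]

theorem norm_toEuclideanLin_realB_le (hB : matB A L xs ωx * (matB A L xs ωx)ᴴ = 1)
    (w : EuclideanSpace ℝ (Fin n ⊕ Fin m)) : ‖toEuclideanLin (realB A L xs ωx) w‖ ≤ ‖w‖ := by
  refine le_of_sq_le_sq ?_ (norm_nonneg _)
  rw [realB, norm_toEuclideanLin_fromRows_re_im, ← norm_toLp_ofReal w,
    ← norm_sq_add_norm_sub_conjTranspose_sq hB]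
  exact le_add_of_nonneg_right (sq_nonneg _)

theorem exists_eq_of_norm_toEuclideanLin_realB_eq
    (hB : matB A L xs ωx * (matB A L xs ωx)ᴴ = 1) {w : EuclideanSpace ℝ (Fin n ⊕ Fin m)}
    (hw : ‖toEuclideanLin (realB A L xs ωx) w‖ = ‖w‖) :
    ∃ x : EuclideanSpace ℂ (Fin n), ∀ i,
      (w i : ℂ) =
        star (Sum.elim ωx (fun i => phase (meas A xs i)) i) * Sum.elim x (meas A x) i := by
  rw [realB, norm_toEuclideanLin_fromRows_re_im, ← norm_toLp_ofReal w] at hw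
  set u : EuclideanSpace ℂ (Fin n ⊕ Fin m) := WithLp.toLp 2 fun i => (w i : ℂ)
  have hu : u = toEuclideanLin (matB A L xs ωx)ᴴ (toEuclideanLin (matB A L xs ωx) u) := by
    have hpyth := norm_sq_add_norm_sub_conjTranspose_sq hB u
    rw [hw, add_eq_left, sq_eq_zero_iff, norm_eq_zero] at hpyth
    exact sub_eq_zero.1 hpyth
  exact ⟨_, fun i => (congrArg (· i) hu).trans (toEuclideanLin_conjTranspose_matB_apply _ i)⟩

theorem sigma2_lt_one (hmag : MagnitudeRetrievalUnique A xs) (h0 : ∀ i, meas A xs i ≠ 0)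
    (hL : L * Lᴴ = 1 + A * Aᴴ) (hω : ∀ j, ‖ωx j‖ = 1) : sigma2 A L xs ωx < 1 := by
  have hB := matB_mul_conjTranspose hL h0 hω
  let w₀ : EuclideanSpace ℝ (Fin n ⊕ Fin m) := WithLp.toLp 2 fun i =>
    (star (Sum.elim ωx (fun i => phase (meas A xs i)) i) * Sum.elim xs (meas A xs) i).re
  refine singularValues_lt_one _ (ℝ ∙ w₀) ((finrank_span_le_card _).trans (by simp))
    (norm_toEuclideanLin_realB_le hB) fun w hw => ?_
  obtain ⟨x, hx⟩ := exists_eq_of_norm_toEuclideanLin_realB_eq hB hw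
  obtain ⟨c, rfl⟩ := hmag.eq_smul (x := x) fun i => ⟨w (.inr i) / ‖meas A xs i‖, by
    have hphase : phase (meas A xs i) * star (phase (meas A xs i)) = 1 := by
      rw [Complex.star_def, Complex.mul_conj, Complex.normSq_eq_norm_sq, norm_phase (h0 i)]
      simp
    have hne : (‖meas A xs i‖ : ℂ) ≠ 0 := mod_cast norm_ne_zero_iff.2 (h0 i)
    calc meas A x i = phase (meas A xs i) * (w (.inr i) : ℂ) := by
          rw [hx, Sum.elim_inr, Sum.elim_inr, ← mul_assoc, hphase, one_mul]
      _ = (w (.inr i) / ‖meas A xs i‖ : ℝ) * (‖meas A xs i‖ * phase (meas A xs i)) := by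
          push_cast
          field_simp
      _ = (w (.inr i) / ‖meas A xs i‖ : ℝ) * meas A xs i := by rw [norm_mul_phase]⟩
  refine Submodule.mem_span_singleton.2 ⟨c, ?_⟩
  ext i
  have hxi : Sum.elim ((c : ℂ) • xs) (meas A ((c : ℂ) • xs)) i
      = c * Sum.elim xs (meas A xs) i := by
    cases i <;> simp
  rw [← Complex.ofReal_re (w i), hx, hxi, mul_left_comm, Complex.re_ofReal_mul]
  rfl

theorem sMin_pos (hA : A ≠ 0) : 0 < sMin A := by
  set T := toEuclideanLin A with hTA
  have hfin : {s : ℝ | s ≠ 0 ∧ ∃ i : ℕ, s = T.singularValues i}.Finite := by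
    refine (T.singularValues.support.finite_toSet.image T.singularValues).subset ?_
    rintro s ⟨hs, i, rfl⟩
    exact ⟨i, Finsupp.mem_support_iff.2 hs, rfl⟩
  have hT : T.singularValues ≠ 0 := by
    rwa [Ne, T.singularValues_eq_zero_iff, hTA, map_eq_zero_iff _ (LinearEquiv.injective _)]
  obtain ⟨i, hi⟩ := DFunLike.ne_iff.1 hT
  have hmem : sMin A ∈ {s : ℝ | s ≠ 0 ∧ ∃ i : ℕ, s = T.singularValues i} :=
    Set.Nonempty.csInf_mem ⟨_, hi, i, rfl⟩ hfin
  obtain ⟨hne, j, hj⟩ := hmem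
  exact lt_of_le_of_ne ((T.singularValues_nonneg j).trans_eq hj.symm) hne.symm

theorem delta1_mem_Ioo (h : 0 < sMin A) : delta1 A ∈ Set.Ioo 0 1 := by
  have hsqrt : 1 < √(1 + sMin A ^ 2) := Real.lt_sqrt_of_sq_lt (by nlinarith)
  exact ⟨by unfold delta1; positivity, (div_lt_one (one_pos.trans hsqrt)).2 hsqrt⟩

theorem betaTilde_mem_Ioo (hσ : sigma2 A L xs ωx < 1) (hδ : delta1 A ∈ Set.Ioo 0 1) :
    betaTilde A L xs ωx ∈ Set.Ioo 0 1 := by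
  have hσ0 : 0 ≤ sigma2 A L xs ωx := LinearMap.singularValues_nonneg _ 1
  have hσ1 : sigma2 A L xs ωx ^ 2 < 1 := pow_lt_one₀ hσ0 hσ two_ne_zero
  have hδ0 : 0 < delta1 A ^ 2 := pow_pos hδ.1 2
  have hδ1 : delta1 A ^ 2 < 1 := pow_lt_one₀ hδ.1.le hδ.2 two_ne_zero
  constructor
  · exact Real.sqrt_pos.2 (lt_max_of_lt_left (by nlinarith [sq_nonneg (sigma2 A L xs ωx)]))
  · rw [betaTilde, Real.sqrt_lt' one_pos]
    exact max_lt (by nlinarith) (by linarith)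

theorem tMax_mem_Ioo {β : ℝ} (hβ : β ∈ Set.Ioo (0 : ℝ) 1) : tMax β ∈ Set.Ioo 0 1 := by
  have hβ0 : 0 < β ^ 2 := pow_pos hβ.1 2
  have hβ1 : β ^ 2 < 1 := pow_lt_one₀ hβ.1.le hβ.2 two_ne_zero
  exact ⟨div_pos (by linarith) (by linarith), (div_lt_one (by linarith)).2 (by linarith)⟩

end SingularValues

section Derivative

variable {n m : ℕ}

/-- The real-orthogonal projection onto the tangent space at `y` of the torus of vectors with the
same moduli as `y`: the derivative at `y` of the projection `proxF` onto this torus. -/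
noncomputable def tangentProj (y : EuclideanSpace ℂ (Fin m)) :
    EuclideanSpace ℂ (Fin m) →L[ℝ] EuclideanSpace ℂ (Fin m) :=
  (PiLp.continuousLinearEquiv 2 ℝ fun _ : Fin m => ℂ).symm.toContinuousLinearMap ∘L
    ContinuousLinearMap.pi fun i => (ℝ ∙ y i)ᗮ.starProjection ∘L PiLp.proj 2 (fun _ => ℂ) i

theorem tangentProj_apply (y v : EuclideanSpace ℂ (Fin m)) (i : Fin m) :
    tangentProj y v i = (ℝ ∙ y i)ᗮ.starProjection (v i) :=
  rfl

theorem norm_tangentProj_sq_add (y v : EuclideanSpace ℂ (Fin m)) :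
    ‖tangentProj y v‖ ^ 2 + ‖v - tangentProj y v‖ ^ 2 = ‖v‖ ^ 2 := by
  simp only [EuclideanSpace.norm_sq_eq, ← Finset.sum_add_distrib]
  refine Finset.sum_congr rfl fun i _ => ?_
  rw [PiLp.sub_apply, tangentProj_apply, ← Submodule.starProjection_orthogonal_val,
    ← Submodule.norm_sq_eq_add_norm_sq_starProjection]

theorem hasFDerivAt_proxF {b : Fin m → ℝ} {y : EuclideanSpace ℂ (Fin m)} (h0 : ∀ i, y i ≠ 0)
    (hy : ∀ i, ‖y i‖ = b i) : HasFDerivAt (proxF b) (tangentProj y) y := by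
  refine (PiLp.continuousLinearEquiv 2 ℝ fun _ : Fin m => ℂ).symm.hasFDerivAt.comp
    (f := fun w : EuclideanSpace ℂ (Fin m) => fun i => (b i : ℂ) * phase (w i)) y
    (hasFDerivAt_pi.2 fun i => ?_)
  have hcoord : HasFDerivAt (fun w : ℂ => (b i : ℂ) * phase w) (ℝ ∙ y i)ᗮ.starProjection (y i) := by
    have hscaled := (hasFDerivAt_normalize (h0 i)).const_smul (b i)
    rw [smul_smul, hy i, mul_inv_cancel₀ (hy i ▸ norm_ne_zero_iff.2 (h0 i)), one_smul] at hscaled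
    have hfun : (fun w => (b i : ℂ) * phase w) = b i • NormedSpace.normalize := by
      ext1 w
      rw [phase_eq_normalize, Pi.smul_apply, Complex.real_smul]
    exact hfun ▸ hscaled
  exact HasFDerivAt.comp (g := fun w : ℂ => (b i : ℂ) * phase w)
    (f := fun w : EuclideanSpace ℂ (Fin m) => w i) y hcoord
    (PiLp.proj 2 (𝕜 := ℝ) (fun _ : Fin m => ℂ) i).hasFDerivAt

/-- The derivative of `proxPhi`: the identity in `x` and `tangentProj y` in `y`. -/
noncomputable def stackedTangentProj (n : ℕ) (y : EuclideanSpace ℂ (Fin m)) :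
    Stacked n m →L[ℝ] Stacked n m :=
  (WithLp.prodContinuousLinearEquiv 2 ℝ _ _).symm.toContinuousLinearMap ∘L
    ((ContinuousLinearMap.id ℝ (EuclideanSpace ℂ (Fin n))).prodMap (tangentProj y)) ∘L
    (WithLp.prodContinuousLinearEquiv 2 ℝ _ _).toContinuousLinearMap

theorem stackedTangentProj_apply (y : EuclideanSpace ℂ (Fin m)) (v : Stacked n m) :
    stackedTangentProj n y v = stack v.fst (tangentProj y v.snd) :=
  rfl

theorem norm_stackedTangentProj_sq_add (y : EuclideanSpace ℂ (Fin m)) (v : Stacked n m) :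
    ‖stackedTangentProj n y v‖ ^ 2 + ‖v - stackedTangentProj n y v‖ ^ 2 = ‖v‖ ^ 2 := by
  simp only [stackedTangentProj_apply, WithLp.prod_norm_sq_eq_of_L2, WithLp.sub_fst,
    WithLp.sub_snd, WithLp.toLp_fst, WithLp.toLp_snd, sub_self, norm_zero]
  linarith [norm_tangentProj_sq_add y v.snd]

theorem hasFDerivAt_proxPhi {b : Fin m → ℝ} {z : Stacked n m} (h0 : ∀ i, z.snd i ≠ 0)
    (hz : ∀ i, ‖z.snd i‖ = b i) : HasFDerivAt (proxPhi b) (stackedTangentProj n z.snd) z := by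
  let e := WithLp.prodContinuousLinearEquiv 2 ℝ (EuclideanSpace ℂ (Fin n))
    (EuclideanSpace ℂ (Fin m))
  have hprod : HasFDerivAt (Prod.map id (proxF b))
      ((ContinuousLinearMap.id ℝ _).prodMap (tangentProj z.snd)) (e z) :=
    .prodMap (e z) (hasFDerivAt_id _) (hasFDerivAt_proxF h0 hz)
  exact e.symm.hasFDerivAt.comp z (hprod.comp z e.hasFDerivAt)

/-- The map `robustProj` as a continuous real-linear map. -/
noncomputable def robustProjCLM (A : Matrix (Fin n) (Fin m) ℂ) (t : ℝ) :
    Stacked n m →L[ℝ] Stacked n m :=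
  ((t : ℂ) • ContinuousLinearMap.id ℂ _ + ((1 - t : ℝ) : ℂ) • graphProj A).restrictScalars ℝ

/-- The derivative of `rgpsDRStep` at a point `(x, y)` with `|y| = b`. -/
noncomputable def rgpsDRDeriv (A : Matrix (Fin n) (Fin m) ℂ) (t : ℝ)
    (y : EuclideanSpace ℂ (Fin m)) : Stacked n m →L[ℝ] Stacked n m :=
  .id ℝ _ + robustProjCLM A t ∘L ((2 : ℝ) • stackedTangentProj n y - .id ℝ _)
    - stackedTangentProj n y

variable {A : Matrix (Fin n) (Fin m) ℂ} {b : Fin m → ℝ} {xs : EuclideanSpace ℂ (Fin n)} {t : ℝ}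

theorem hasFDerivAt_rgpsDRStep {z : Stacked n m} (h0 : ∀ i, z.snd i ≠ 0)
    (hz : ∀ i, ‖z.snd i‖ = b i) (t : ℝ) :
    HasFDerivAt (rgpsDRStep A b t) (rgpsDRDeriv A t z.snd) z :=
  have hprox := hasFDerivAt_proxPhi h0 hz
  ((hasFDerivAt_id z).add ((robustProjCLM A t).hasFDerivAt.comp z
    ((hprox.const_smul (2 : ℝ)).sub (hasFDerivAt_id z)))).sub hprox

theorem norm_rgpsDRDeriv_sq_add_le (ht0 : 0 ≤ t) (ht1 : t ≤ 1) (y : EuclideanSpace ℂ (Fin m))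
    (v : Stacked n m) :
    ‖rgpsDRDeriv A t y v‖ ^ 2
        + (1 - t) * ‖(graphSet A)ᗮ.starProjection (stackedTangentProj n y v)‖ ^ 2
        + t * ‖v - stackedTangentProj n y v‖ ^ 2 ≤ ‖v‖ ^ 2 := by
  set q := stackedTangentProj n y v
  have hderiv : rgpsDRDeriv A t y v = (v - q) + ((t : ℂ) • (q - (v - q)) +
      ((1 - t : ℝ) : ℂ) • (graphSet A).starProjection (q - (v - q))) := by
    have hreflect : q - (v - q) = (2 : ℝ) • q - v := by module
    rw [hreflect]
    change v + ((t : ℂ) • ((2 : ℝ) • q - v) +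
      ((1 - t : ℝ) : ℂ) • (graphSet A).starProjection ((2 : ℝ) • q - v)) - q = _
    abel
  rw [hderiv, ← norm_stackedTangentProj_sq_add y v]
  exact norm_sq_relaxed_reflection_add_le (graphSet A) ht0 ht1 q (v - q)

theorem exists_I_mul_eq_ofReal_mul {y w : ℂ} (hy : y ≠ 0) (h : inner ℝ y w = 0) :
    ∃ r : ℝ, Complex.I * w = r * y := by
  have hre : (w / y).re = 0 := by
    rw [Complex.inner, Complex.mul_re, Complex.conj_re, Complex.conj_im] at h
    rw [Complex.div_re, ← add_div, div_eq_zero_iff]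
    left
    linarith
  obtain ⟨s, hs⟩ : ∃ s : ℝ, w / y = s * Complex.I :=
    ⟨(w / y).im, Complex.ext (by simpa using hre) (by simp)⟩
  refine ⟨-s, ?_⟩
  rw [Complex.ofReal_neg, (div_eq_iff hy).1 hs]
  linear_combination s * y * Complex.I_mul_I

theorem stacked_ext {u v : Stacked n m} (hfst : u.fst = v.fst) (hsnd : u.snd = v.snd) : u = v :=
  WithLp.ofLp_injective 2 (Prod.ext hfst hsnd)

theorem MagnitudeRetrievalUnique.eq_smul_of_mem_graphSet (hmag : MagnitudeRetrievalUnique A xs)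
    (h0 : ∀ i, meas A xs i ≠ 0) {v : Stacked n m} (hv : v ∈ graphSet A)
    (htan : stackedTangentProj n (meas A xs) v = v) :
    ∃ c : ℝ, v = (c * Complex.I) • stack xs (meas A xs) := by
  have hgraph : meas A v.fst = v.snd := hv
  have horth (i) : inner ℝ (meas A xs i) (v.snd i) = 0 := by
    refine Submodule.mem_orthogonal_singleton_iff_inner_right.1
      (Submodule.starProjection_eq_self_iff.1 ?_)
    exact congrArg (fun z : Stacked n m => z.snd i) htan
  obtain ⟨c, hc⟩ := hmag.eq_smul (x := Complex.I • v.fst) fun i => by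
    rw [map_smul, hgraph]
    exact exists_I_mul_eq_ofReal_mul (h0 i) (horth i)
  have hfst : v.fst = ((-c : ℝ) * Complex.I) • xs := by
    rw [mul_comm, mul_smul, Complex.ofReal_neg, neg_smul, ← hc, smul_neg, smul_smul,
      Complex.I_mul_I, neg_one_smul, neg_neg]
  refine ⟨-c, stacked_ext hfst ?_⟩
  change v.snd = ((-c : ℝ) * Complex.I) • meas A xs
  rw [← hgraph, hfst, map_smul]

theorem norm_rgpsDRDeriv_lt (hmag : MagnitudeRetrievalUnique A xs) (h0 : ∀ i, meas A xs i ≠ 0)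
    (ht : t ∈ Set.Ioo 0 1) {v : Stacked n m} (hv : v ∈ phaseSlice (stack xs (meas A xs)))
    (hv0 : v ≠ 0) : ‖rgpsDRDeriv A t (meas A xs) v‖ < ‖v‖ := by
  set q := stackedTangentProj n (meas A xs) v
  have hdecr := norm_rgpsDRDeriv_sq_add_le (A := A) ht.1.le ht.2.le (meas A xs) v
  contrapose! hv0
  have hsq := pow_le_pow_left₀ (norm_nonneg _) hv0 2
  have hgap0 : 0 ≤ (1 - t) * ‖(graphSet A)ᗮ.starProjection q‖ ^ 2 :=
    mul_nonneg (sub_nonneg.2 ht.2.le) (sq_nonneg _)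
  have hnormal0 : 0 ≤ t * ‖v - q‖ ^ 2 := mul_nonneg ht.1.le (sq_nonneg _)
  have htan : q = v := by
    have hzero : ‖v - q‖ ^ 2 = 0 :=
      (mul_eq_zero_iff_left ht.1.ne').1 (by linarith)
    exact (sub_eq_zero.1 (norm_eq_zero.1 (sq_eq_zero_iff.1 hzero))).symm
  have hgraph : v ∈ graphSet A := by
    have hzero : ‖(graphSet A)ᗮ.starProjection q‖ ^ 2 = 0 :=
      (mul_eq_zero_iff_left (sub_pos.2 ht.2).ne').1 (by linarith)
    rw [sq_eq_zero_iff, norm_eq_zero, Submodule.starProjection_orthogonal_val, sub_eq_zero,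
      htan] at hzero
    exact Submodule.starProjection_eq_self_iff.1 hzero.symm
  obtain ⟨c, rfl⟩ := hmag.eq_smul_of_mem_graphSet h0 hgraph htan
  exact real_smul_I_smul_eq_zero_of_mem_phaseSlice hv

end Derivative

section Iteration

variable {n m : ℕ} {A : Matrix (Fin n) (Fin m) ℂ} {b : Fin m → ℝ} {xs : EuclideanSpace ℂ (Fin n)}

theorem proxF_circle_smul (α : Circle) (y : EuclideanSpace ℂ (Fin m)) :
    proxF b ((α : ℂ) • y) = (α : ℂ) • proxF b y := by
  ext i
  simp only [proxF, PiLp.smul_apply, smul_eq_mul, phase_circle_mul, mul_left_comm]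

theorem proxF_eq_self {y : EuclideanSpace ℂ (Fin m)} (hy : ∀ i, ‖y i‖ = b i) :
    proxF b y = y := by
  ext i
  rw [proxF, PiLp.toLp_apply, ← hy i, norm_mul_phase]

theorem rgpsDRStep_circle_smul (t : ℝ) (α : Circle) (z : Stacked n m) :
    rgpsDRStep A b t ((α : ℂ) • z) = (α : ℂ) • rgpsDRStep A b t z := by
  have hprox : proxPhi b ((α : ℂ) • z) = (α : ℂ) • proxPhi b z :=
    stacked_ext rfl (proxF_circle_smul α z.snd)
  simp only [rgpsDRStep, robustProj, hprox, map_sub, map_smul]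
  module

theorem rgpsDRStep_stack_meas (hxs : ∀ i, ‖meas A xs i‖ = b i) (t : ℝ) :
    rgpsDRStep A b t (stack xs (meas A xs)) = stack xs (meas A xs) := by
  have hprox : proxPhi b (stack xs (meas A xs)) = stack xs (meas A xs) :=
    stacked_ext rfl (proxF_eq_self hxs)
  have hgraph : graphProj A (stack xs (meas A xs)) = stack xs (meas A xs) :=
    (graphSet A).starProjection_eq_self_iff.2 rfl
  simp only [rgpsDRStep, robustProj, hprox, map_sub, map_smul, hgraph]
  push_cast
  module

theorem exists_phaseDist_rgpsDRStep_le (hmag : MagnitudeRetrievalUnique A xs)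
    (h0 : ∀ i, meas A xs i ≠ 0) (hxs : ∀ i, ‖meas A xs i‖ = b i) {t : ℝ} (ht : t ∈ Set.Ioo 0 1) :
    ∃ γ ∈ Set.Ioo (0 : ℝ) 1, ∃ r > 0, ∀ z, phaseDist z (stack xs (meas A xs)) < r →
      phaseDist (rgpsDRStep A b t z) (stack xs (meas A xs))
        ≤ γ * phaseDist z (stack xs (meas A xs)) :=
  exists_phaseDist_apply_le_mul (rgpsDRStep_circle_smul t) (rgpsDRStep_stack_meas hxs t)
    (hasFDerivAt_rgpsDRStep h0 hxs t) fun _ => norm_rgpsDRDeriv_lt hmag h0 ht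

theorem rgpsStep_lam (t : ℝ) (s : State n m) : (rgpsStep A b t s).lam = 0 := by
  simp only [rgpsStep, proxPhi, WithLp.toLp_fst]
  abel

theorem stack_rgpsStep (t : ℝ) (s : State n m) :
    stack (rgpsStep A b t s).x (rgpsStep A b t s).y = proxPhi b (rgpsStep A b t s).dr := by
  refine stacked_ext ?_ ?_
  · simp only [rgpsStep, proxPhi, State.dr, WithLp.toLp_fst]
    abel
  · simp only [rgpsStep, proxPhi, State.dr, WithLp.toLp_fst, WithLp.toLp_snd]
    congr 1
    abel

theorem dr_rgpsStep (t : ℝ) {s : State n m} (hs : stack s.x s.y = proxPhi b s.dr) :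
    (rgpsStep A b t s).dr = rgpsDRStep A b t s.dr := by
  have hreflect : stack (s.x - s.lam) (s.y - s.nu) = (2 : ℂ) • proxPhi b s.dr - s.dr := by
    rw [← hs]
    refine stacked_ext ?_ ?_
    · change s.x - s.lam = (2 : ℂ) • s.x - (s.lam + s.x)
      module
    · change s.y - s.nu = (2 : ℂ) • s.y - (s.nu + s.y)
      module
  rw [rgpsDRStep, ← hreflect, ← hs]
  refine stacked_ext ?_ ?_ <;>
  · simp only [rgpsStep, State.dr, WithLp.toLp_fst, WithLp.toLp_snd, WithLp.add_fst,
      WithLp.add_snd, WithLp.sub_fst, WithLp.sub_snd]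
    abel

theorem phaseDist_rgpsStep_x_le (t : ℝ) (s : State n m) (z : Stacked n m) :
    phaseDist (rgpsStep A b t s).x z.fst ≤ phaseDist (rgpsStep A b t s).dr z := by
  have hx : (rgpsStep A b t s).dr.fst = (rgpsStep A b t s).x := by
    rw [State.dr, WithLp.toLp_fst, rgpsStep_lam, zero_add]
  exact hx ▸ phaseDist_fst_le _ z

theorem phaseDist_rgps_x_le {t γ r : ℝ} {z : Stacked n m} (hγ : γ ∈ Set.Ioo 0 1)
    (hstep : ∀ w, phaseDist w z < r → phaseDist (rgpsDRStep A b t w) z ≤ γ * phaseDist w z)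
    {s : ℕ → State n m} (hs : ∀ k, s (k + 1) = rgpsStep A b t (s k))
    (h1 : phaseDist (s 1).dr z < r) (k : ℕ) :
    phaseDist (s (k + 1)).x z.fst ≤ γ ^ k * phaseDist (s 1).dr z := by
  have hdr (k) : (s (k + 2)).dr = rgpsDRStep A b t (s (k + 1)).dr := by
    rw [hs (k + 1)]
    exact dr_rgpsStep t (hs k ▸ stack_rgpsStep t (s k))
  calc phaseDist (s (k + 1)).x z.fst ≤ phaseDist (s (k + 1)).dr z :=
        hs k ▸ phaseDist_rgpsStep_x_le t (s k) z
    _ ≤ γ ^ k * phaseDist (s 1).dr z :=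
        le_pow_mul_of_lt_imp_le_mul (d := fun k => phaseDist (s (k + 1)).dr z) hγ.1.le hγ.2.le
          (phaseDist_nonneg _ _) h1 (fun k hk => hdr k ▸ hstep _ hk) k

end Iteration

end PhaseRetrieval

open PhaseRetrieval in
theorem theorem3p3_general {n m : ℕ} (hn : 0 < n) (A : Matrix (Fin n) (Fin m) ℂ) (b : Fin m → ℝ)
    (xs : EuclideanSpace ℂ (Fin n)) (hxs : ∀ i, ‖meas A xs i‖ = b i) (hb : ∀ i, 0 < b i)
    (hmag : MagnitudeRetrievalUnique A xs)
    (L : Matrix (Fin n) (Fin n) ℂ) (hL : L * Lᴴ = 1 + A * Aᴴ)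
    (ωx : Fin n → ℂ) (hω : ∀ j, ‖ωx j‖ = 1 ∧ xs j = (‖xs j‖ : ℂ) * ωx j) :
    let zs := stack xs (meas A xs)
    let β := betaTilde A L xs ωx
    β ∈ Set.Ioo 0 1 ∧ tMax β ∈ Set.Ioo 0 1 ∧
    ∀ t ∈ Set.Ioo (0 : ℝ) 1, ∃ γ ∈ Set.Ioo (0 : ℝ) 1, ∃ r > 0,
      (∀ z, phaseDist z zs < r → (rgpsDRStep A b t z = z ↔ z ∈ phaseOrbit zs)) ∧
      ∀ s : ℕ → State n m, (∀ k, s (k + 1) = rgpsStep A b t (s k)) → phaseDist (s 1).dr zs < r →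
        ∀ k, phaseDist (s (k + 1)).x xs ≤ γ ^ k * phaseDist (s 1).dr zs := by
  intro zs β
  have h0 (i) : meas A xs i ≠ 0 := norm_pos_iff.1 (hxs i ▸ hb i)
  have hσ : sigma2 A L xs ωx < 1 := sigma2_lt_one hmag h0 hL fun j => (hω j).1
  have hδ : delta1 A ∈ Set.Ioo 0 1 := delta1_mem_Ioo (sMin_pos (hmag.matrix_ne_zero hn))
  have hβ : β ∈ Set.Ioo 0 1 := betaTilde_mem_Ioo hσ hδ
  refine ⟨hβ, tMax_mem_Ioo hβ, fun t ht => ?_⟩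
  obtain ⟨γ, hγ, r, hr, hstep⟩ := exists_phaseDist_rgpsDRStep_le hmag h0 hxs ht
  refine ⟨γ, hγ, r, hr, fun z hz => ?_, fun s hs h1 k => phaseDist_rgps_x_le hγ hstep hs h1 k⟩
  exact apply_eq_self_iff_of_phaseDist_le (rgpsDRStep_circle_smul t)
    (rgpsDRStep_stack_meas hxs t) hγ.2 hstep hz

theorem theorem3p3 {n m : ℕ} (hn : 0 < n)
    (A : Matrix (Fin n) (Fin m) ℂ) (b : Fin m → ℝ) (xs : EuclideanSpace ℂ (Fin n))
    (hA : Function.Injective (PhaseRetrieval.meas A))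
    (hxs : ∀ i, ‖PhaseRetrieval.meas A xs i‖ = b i)
    (hb : ∀ i, 0 < b i)
    (hmag : PhaseRetrieval.MagnitudeRetrievalUnique A xs)
    (L : Matrix (Fin n) (Fin n) ℂ) (hL : L * Lᴴ = 1 + A * Aᴴ)
    (ωx : Fin n → ℂ) (hω : ∀ j, ‖ωx j‖ = 1 ∧ xs j = (‖xs j‖ : ℂ) * ωx j) :
    let zs := PhaseRetrieval.stack xs (PhaseRetrieval.meas A xs)
    let β := PhaseRetrieval.betaTilde A L xs ωx
    (0 < β ∧ β < 1) ∧ (0 < PhaseRetrieval.tMax β ∧ PhaseRetrieval.tMax β < 1) ∧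
    ∀ t : ℝ, 0 < t → t < PhaseRetrieval.tMax β →
      ∃ γ : ℝ, 0 < γ ∧ γ < 1 ∧
        ∃ ε : ℝ → ℝ, Tendsto ε (𝓝[>] 0) (𝓝 0) ∧
          ∃ r : ℝ, 0 < r ∧
            (∀ z : PhaseRetrieval.Stacked n m, PhaseRetrieval.phaseDist z zs < r →
              (PhaseRetrieval.rgpsDRStep A b t z = z ↔ z ∈ PhaseRetrieval.phaseOrbit zs)) ∧
            ∀ s : ℕ → PhaseRetrieval.State n m,
              (∀ k, s (k + 1) = PhaseRetrieval.rgpsStep A b t (s k)) →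
              PhaseRetrieval.phaseDist (s 1).dr zs < r →
              ∀ k : ℕ, 1 ≤ k →
                PhaseRetrieval.phaseDist (s k).x xs ≤
                  (γ + ε (PhaseRetrieval.phaseDist (s 1).dr zs)) ^ (k - 1) *
                    PhaseRetrieval.phaseDist (s 1).dr zs := by
  obtain ⟨hβ, hT, hconv⟩ := theorem3p3_general hn A b xs hxs hb hmag L hL ωx hω
  refine ⟨hβ, hT, fun t ht0 ht => ?_⟩
  obtain ⟨γ, hγ, r, hr, hfix, hrate⟩ := hconv t ⟨ht0, ht.trans hT.2⟩
  refine ⟨γ, hγ.1, hγ.2, fun _ => 0, tendsto_const_nhds, r, hr, hfix, fun s hs h1 k hk => ?_⟩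
  obtain ⟨k, rfl⟩ := Nat.exists_eq_add_of_le' hk
  simpa using hrate s hs h1 k
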